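/- Let $\mathbb F$ be a field of characteristic zero. Let $E$ be the Grassmann algebra without identity element on countably many generators, that is, the associative non-unital $\mathbb F$-algebra generated by $e_1,e_2,\dots$ with relations $e_ie_j=-e_je_i$ and $e_i^2=0$ for all $i,j$. Let $E_0$ (respectively $E_1$) be the linear span of the monomials in the $e_i$ of positive even (respectively odd) length, and let $M_{1,1}(E)$ be the algebra of all matrices $\begin{pmatrix} a & b\\ d & c\end{pmatrix}$ with $a,c\in E_0$ and $b,d\in E_1$, regarded as a Lie algebra over $\mathbb F$ with bracket $[A,B]=AB-BA$. Let $L(X)$ be the free Lie $\mathbb F$-algebra on the countable set $X=\{x_1,x_2,\dots\}$. An element $f\in L(X)$ is a polynomial identity of a Lie algebra $A$ if $f(a_1,a_2,\dots)=0$ for all $a_1,a_2,\dots\in A$. Then the polynomial identities of the Lie algebra $M_{1,1}(E)$ have a basis consisting of the single identity $$[x_1,x_2,[x_3,x_4],x_5]=[[[x_1,x_2],[x_3,x_4]],x_5]=0;$$ that is, an element $f\in L(X)$ is a polynomial identity of $M_{1,1}(E)$ if and only if $f$ belongs to the ideal of $L(X)$ generated by all the elements $[[[g_1,g_2],[g_3,g_4]],g_5]$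 with $g_1,\dots,g_5\in L(X)$. -/

import Mathlib

namespace LieIdentities

section Grassmann

attribute [local instance 100] LieRing.ofAssociativeRing

variable (F : Type*) [Field F]

/-- The Grassmann algebra with identity element on countably many generators. -/
abbrev UnitalGrassmann : Type _ := ExteriorAlgebra F (ℕ →₀ F)

/-- The generators of the Grassmann algebra. -/
noncomputable def gen (i : ℕ) : UnitalGrassmann F :=
  ExteriorAlgebra.ι F (Finsupp.single i 1)

/-- The monomial `e_{i₁} ⋯ e_{iₖ}` attached to a list of indices. -/
noncomputable def monomial (l : List ℕ) : UnitalGrassmann F :=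
  (l.map (gen F)).prod

/-- The Grassmann algebra `E` without identity element: the non-unital subalgebra generated by
the generators. -/
noncomputable def grassmann : NonUnitalSubalgebra F (UnitalGrassmann F) :=
  NonUnitalAlgebra.adjoin F (Set.range (gen F))

/-- The even part `E₀` of `E`: the span of the monomials of positive even length. -/
noncomputable def evenPart : Submodule F (UnitalGrassmann F) :=
  Submodule.span F {w | ∃ l : List ℕ, l ≠ [] ∧ Even l.length ∧ w = monomial F l}

/-- The odd part `E₁` of `E`: the span of the monomials of odd length. -/
noncomputable def oddPart : Submodule F (UnitalGrassmann F) :=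
  Submodule.span F {w | ∃ l : List ℕ, Odd l.length ∧ w = monomial F l}

theorem monomial_append (l m : List ℕ) :
    monomial F (l ++ m) = monomial F l * monomial F m := by
  simp [monomial]

theorem monomial_mem (l : List ℕ) (hl : l ≠ []) : monomial F l ∈ grassmann F := by
  induction l with
  | nil => exact absurd rfl hl
  | cons i l ih =>
    have hi : gen F i ∈ grassmann F := NonUnitalAlgebra.subset_adjoin F ⟨i, rfl⟩
    rcases eq_or_ne l [] with rfl | h
    · simpa [monomial] using hi
    · have : monomial F (i :: l) = gen F i * monomial F l := by simp [monomial]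
      rw [this]
      exact mul_mem hi (ih h)

theorem span_mul_mem {S T : Set (UnitalGrassmann F)} {N : Submodule F (UnitalGrassmann F)}
    (h : ∀ s ∈ S, ∀ t ∈ T, s * t ∈ N) {x y : UnitalGrassmann F}
    (hx : x ∈ Submodule.span F S) (hy : y ∈ Submodule.span F T) : x * y ∈ N := by
  have h1 : x * y ∈ Submodule.span F S * Submodule.span F T := Submodule.mul_mem_mul hx hy
  rw [Submodule.span_mul_span] at h1
  refine Submodule.span_le.2 ?_ h1
  rintro _ ⟨s, hs, t, ht, rfl⟩
  exact h s hs t ht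

theorem even_mul_even {x y : UnitalGrassmann F} (hx : x ∈ evenPart F) (hy : y ∈ evenPart F) :
    x * y ∈ evenPart F := by
  refine span_mul_mem F ?_ hx hy
  rintro _ ⟨l, hl, hl', rfl⟩ _ ⟨m, hm, hm', rfl⟩
  exact Submodule.subset_span
    ⟨l ++ m, by simp [hl], by simpa using hl'.add hm', (monomial_append F l m).symm⟩

theorem even_mul_odd {x y : UnitalGrassmann F} (hx : x ∈ evenPart F) (hy : y ∈ oddPart F) :
    x * y ∈ oddPart F := by
  refine span_mul_mem F ?_ hx hy
  rintro _ ⟨l, hl, hl', rfl⟩ _ ⟨m, hm', rfl⟩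
  exact Submodule.subset_span
    ⟨l ++ m, by simpa using hl'.add_odd hm', (monomial_append F l m).symm⟩

theorem odd_mul_even {x y : UnitalGrassmann F} (hx : x ∈ oddPart F) (hy : y ∈ evenPart F) :
    x * y ∈ oddPart F := by
  refine span_mul_mem F ?_ hx hy
  rintro _ ⟨l, hl', rfl⟩ _ ⟨m, hm, hm', rfl⟩
  exact Submodule.subset_span
    ⟨l ++ m, by simpa using hl'.add_even hm', (monomial_append F l m).symm⟩

theorem odd_mul_odd {x y : UnitalGrassmann F} (hx : x ∈ oddPart F) (hy : y ∈ oddPart F) :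
    x * y ∈ evenPart F := by
  refine span_mul_mem F ?_ hx hy
  rintro _ ⟨l, hl', rfl⟩ _ ⟨m, hm', rfl⟩
  refine Submodule.subset_span
    ⟨l ++ m, ?_, by simpa using hl'.add_odd hm', (monomial_append F l m).symm⟩
  rintro h
  have : l = [] := (List.append_eq_nil_iff.1 h).1
  simp [this] at hl'

/-- `E` is spanned by its even and its odd part. -/
theorem evenPart_sup_oddPart : evenPart F ⊔ oddPart F = (grassmann F).toSubmodule := by
  apply le_antisymm
  · refine sup_le (Submodule.span_le.2 ?_) (Submodule.span_le.2 ?_)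
    · rintro _ ⟨l, hl, -, rfl⟩
      exact monomial_mem F l hl
    · rintro _ ⟨l, hl, rfl⟩
      refine monomial_mem F l ?_
      rintro rfl
      simp at hl
  · intro x hx
    have hx' : x ∈ NonUnitalAlgebra.adjoin F (Set.range (gen F)) := hx
    clear hx
    induction hx' using NonUnitalAlgebra.adjoin_induction with
    | mem x h =>
      obtain ⟨i, rfl⟩ := h
      exact Submodule.mem_sup_right
        (Submodule.subset_span ⟨[i], by simp, by simp [monomial]⟩)
    | add x y hx hy h1 h2 => exact add_mem h1 h2
    | zero => exact zero_mem _
    | mul x y hx hy h1 h2 =>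
      obtain ⟨a, ha, b, hb, rfl⟩ := Submodule.mem_sup.1 h1
      obtain ⟨c, hc, d, hd, rfl⟩ := Submodule.mem_sup.1 h2
      rw [add_mul, mul_add, mul_add]
      exact add_mem
        (add_mem (Submodule.mem_sup_left (even_mul_even F ha hc))
          (Submodule.mem_sup_right (even_mul_odd F ha hd)))
        (add_mem (Submodule.mem_sup_right (odd_mul_even F hb hc))
          (Submodule.mem_sup_left (odd_mul_odd F hb hd)))
    | smul r x hx h => exact Submodule.smul_mem _ r h

/-- The associative algebra `M_{1,1}(E)` of all `2 × 2` matrices with diagonal entries in `E₀` and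
off-diagonal entries in `E₁`. -/
noncomputable def assocM11 :
    NonUnitalSubalgebra F (Matrix (Fin 2) (Fin 2) (UnitalGrassmann F)) where
  carrier := {A | A 0 0 ∈ evenPart F ∧ A 1 1 ∈ evenPart F ∧
    A 0 1 ∈ oddPart F ∧ A 1 0 ∈ oddPart F}
  zero_mem' := by simp
  add_mem' := by
    rintro A B ⟨h1, h2, h3, h4⟩ ⟨k1, k2, k3, k4⟩
    exact ⟨add_mem h1 k1, add_mem h2 k2, add_mem h3 k3, add_mem h4 k4⟩
  smul_mem' := by
    rintro c A ⟨h1, h2, h3, h4⟩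
    exact ⟨Submodule.smul_mem _ c h1, Submodule.smul_mem _ c h2, Submodule.smul_mem _ c h3,
      Submodule.smul_mem _ c h4⟩
  mul_mem' := by
    rintro A B ⟨h1, h2, h3, h4⟩ ⟨k1, k2, k3, k4⟩
    simp only [Set.mem_ofPred_eq, Matrix.mul_apply, Fin.sum_univ_two]
    exact ⟨add_mem (even_mul_even F h1 k1) (odd_mul_odd F h3 k4),
      add_mem (odd_mul_odd F h4 k3) (even_mul_even F h2 k2),
      add_mem (even_mul_odd F h1 k3) (odd_mul_even F h3 k2),
      add_mem (odd_mul_even F h4 k1) (even_mul_odd F h2 k4)⟩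

/-- The adjoint Lie algebra of `M_{1,1}(E)`: the same space with bracket `A * B - B * A`. -/
noncomputable def lieM11 :
    LieSubalgebra F (Matrix (Fin 2) (Fin 2) (UnitalGrassmann F)) where
  __ := (assocM11 F).toSubmodule
  lie_mem' := by
    intro A B hA hB
    rw [LieRing.of_associative_ring_bracket]
    exact sub_mem (S := NonUnitalSubalgebra F (Matrix (Fin 2) (Fin 2) (UnitalGrassmann F)))
      (H := assocM11 F) (mul_mem hA hB) (mul_mem hB hA)

end Grassmann

section Identities

variable (F : Type*) [Field F]

/-- Lie polynomials in countably many variables. -/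
abbrev LiePoly : Type _ := FreeLieAlgebra F ℕ

/-- The `i`-th variable. -/
noncomputable def X (i : ℕ) : LiePoly F := FreeLieAlgebra.of F i

variable {F}

/-- The value `f(a₀, a₁, …)` of a Lie polynomial. -/
noncomputable def eval {L : Type*} [LieRing L] [LieAlgebra F L] (a : ℕ → L) (f : LiePoly F) : L :=
  FreeLieAlgebra.lift F a f

variable (F) in
/-- `f` is a polynomial identity of the Lie algebra `L`. -/
def IsIdentity (L : Type*) [LieRing L] [LieAlgebra F L] (f : LiePoly F) : Prop :=
  ∀ a : ℕ → L, eval a f = 0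

/-- The consequences of a set of identities: the ideal of the free Lie algebra generated by all
the polynomials `f(g₀, g₁, …)` with `f ∈ S` and `g₀, g₁, …` Lie polynomials. -/
noncomputable def consequences (S : Set (LiePoly F)) : LieIdeal F (LiePoly F) :=
  LieSubmodule.lieSpan F (LiePoly F) {h | ∃ f ∈ S, ∃ g : ℕ → LiePoly F, h = eval g f}

/-- `S` is a basis of the polynomial identities of `L`: the identities of `L` are exactly the
consequences of `S`. -/
def IsIdentityBasis (L : Type*) [LieRing L] [LieAlgebra F L] (S : Set (LiePoly F)) : Prop :=
  ∀ f : LiePoly F, IsIdentity F L f ↔ f ∈ consequences S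

end Identities

end LieIdentities

namespace LieIdentities

/-! ### Sign rules in the Grassmann algebra, and central square-zero elements for testing -/

section GrassmannFacts

variable (F : Type*) [Field F]

/-! Let `K` be the quotient of the free Lie algebra by the consequences of the identity. Brackets in
`M_{1,1}(E)` have equal diagonal entries, so a bracket of two brackets is a central multiple of the
unit matrix; hence the identity holds and every evaluation descends to `K`. It remains to show that
these evaluations separate the elements of `K` (`eq_zero_of_forall_map_eq_zero`). Two layers are
treated in the same way: values are encoded by a formal coefficient vector, a linear map recovers
the element from that vector, and the functions carrying the coefficients are linearly independent,
so vanishing values force a zero vector.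

Modulo the second derived algebra, the upper right entry of a left-normed word is, up to sign, the
Koszul differential of `x_m dx_a ∧ dx_b`, where the commuting variables are the differences of the
diagonal entries. The de Rham differential inverts it up to the degree (`derivSum_sub_derivSum`,
`recoverWord_leftNormed`).

The second derived algebra is spanned by pairings of a word with a bracket `⁅x c, x d⁆`. Centrality
lets letters move across a pairing with a sign (`lie_act_left`), which yields `PairingRelations`.
The diagonal entry is a combination of `cross` terms, and differentiating in both factors returns a
positive multiple of the pairing (`secondSum_alternating`, `recoverPairing_pairing`).

Independence is tested on matrices whose diagonal entries are sums of elements `e_{2r+2} e_{2r+3}`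
of square zero, which detect multisets by polarization (`prod_pairSum`,
`eq_zero_of_sum_pairSum_eq_zero`). Characteristic zero makes the multiplicities and degree factors
invertible. -/

theorem gen_mul_gen (i j : ℕ) : gen F i * gen F j = -(gen F j * gen F i) :=
  eq_neg_of_add_eq_zero_left (ExteriorAlgebra.ι_add_mul_swap _ _)

theorem gen_mul_self (i : ℕ) : gen F i * gen F i = 0 :=
  ExteriorAlgebra.ι_sq_zero _

theorem monomial_cons (i : ℕ) (l : List ℕ) : monomial F (i :: l) = gen F i * monomial F l := by
  simp [monomial]

theorem monomial_mul_gen (l : List ℕ) (j : ℕ) :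
    monomial F l * gen F j = (-1 : F) ^ l.length • (gen F j * monomial F l) := by
  induction l with
  | nil => simp [monomial]
  | cons i l ih =>
    rw [monomial_cons, mul_assoc, ih, mul_smul_comm, ← mul_assoc, gen_mul_gen, List.length_cons,
      pow_succ, mul_smul, neg_one_smul, neg_mul, mul_assoc]

theorem monomial_mul_monomial (l m : List ℕ) :
    monomial F l * monomial F m =
      (-1 : F) ^ (l.length * m.length) • (monomial F m * monomial F l) := by
  induction m with
  | nil => simp [monomial]
  | cons j m ih =>
    rw [monomial_cons, ← mul_assoc, monomial_mul_gen, smul_mul_assoc, mul_assoc, ih,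
      mul_smul_comm, smul_smul, List.length_cons, mul_add, mul_one, pow_add, mul_comm (_ ^ _ : F),
      mul_assoc]

/-- An element that commutes with the generators is central. -/
theorem mem_center_of_commute_gen {z : UnitalGrassmann F}
    (h : ∀ i, gen F i * z = z * gen F i) : z ∈ Subalgebra.center F (UnitalGrassmann F) := by
  rw [Subalgebra.mem_center_iff]
  intro x
  induction x using ExteriorAlgebra.induction with
  | algebraMap r => exact Algebra.commutes r z
  | ι v =>
    induction v using Finsupp.induction_linear with
    | zero => simp
    | add v w hv hw => rw [map_add, add_mul, mul_add, hv, hw]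
    | single i r =>
      have : Finsupp.single i r = r • (Finsupp.single i 1 : ℕ →₀ F) := by simp
      rw [this, map_smul, smul_mul_assoc, mul_smul_comm]
      exact congrArg (r • ·) (h i)
  | mul a b ha hb => rw [mul_assoc, hb, ← mul_assoc, ha, mul_assoc]
  | add a b ha hb => rw [add_mul, mul_add, ha, hb]

theorem evenPart_le_center :
    evenPart F ≤ (Subalgebra.center F (UnitalGrassmann F)).toSubmodule := by
  refine Submodule.span_le.2 ?_
  rintro _ ⟨l, -, hl, rfl⟩
  refine mem_center_of_commute_gen F fun i => ?_
  rw [monomial_mul_gen, hl.neg_one_pow, one_smul]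

theorem evenPart_commute {x : UnitalGrassmann F} (hx : x ∈ evenPart F) (y : UnitalGrassmann F) :
    y * x = x * y :=
  (Subalgebra.mem_center_iff (R := F)).1 (evenPart_le_center F hx) y

theorem oddPart_anticommute {x y : UnitalGrassmann F} (hx : x ∈ oddPart F) (hy : y ∈ oddPart F) :
    x * y = -(y * x) := by
  rw [oddPart] at hx hy
  induction hx, hy using Submodule.span_induction₂ with
  | mem_mem x y hx hy =>
    obtain ⟨l, hl, rfl⟩ := hx
    obtain ⟨m, hm, rfl⟩ := hy
    rw [monomial_mul_monomial, (hl.mul hm).neg_one_pow, neg_one_smul]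
  | zero_left y hy => simp
  | zero_right x hx => simp
  | add_left x y z _ _ _ h1 h2 => rw [add_mul, mul_add, h1, h2, neg_add]
  | add_right x y z _ _ _ h1 h2 => rw [add_mul, mul_add, h1, h2, neg_add]
  | smul_left r x y _ _ h => rw [smul_mul_assoc, mul_smul_comm, h, smul_neg]
  | smul_right r x y _ _ h => rw [smul_mul_assoc, mul_smul_comm, h, smul_neg]

/-- A product of distinct generators is not zero. -/
theorem monomial_ne_zero {l : List ℕ} (hl : l.Nodup) : monomial F l ≠ 0 := by
  -- Contraction with the `i`-th coordinate is an antiderivation: it kills monomials without `e_i`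
  -- and strips a leading `e_i`, so nonvanishing passes from the tail to the whole monomial.
  have contract : ∀ (i : ℕ) (l : List ℕ), i ∉ l →
      CliffordAlgebra.contractLeft (Q := (0 : QuadraticForm F (ℕ →₀ F)))
        (Finsupp.lapply i) (monomial F l) = 0 := by
    intro i l
    induction l with
    | nil => intro _; exact CliffordAlgebra.contractLeft_one _ _
    | cons j l ih =>
      intro h
      rw [List.mem_cons, not_or] at h
      rw [monomial_cons]
      refine (CliffordAlgebra.contractLeft_ι_mul _ _ _).trans ?_
      rw [ih h.2, mul_zero, sub_zero, Finsupp.lapply_apply, Finsupp.single_eq_of_ne h.1, zero_smul]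
  induction l with
  | nil => simp [monomial]
  | cons i l ih =>
    rw [List.nodup_cons] at hl
    intro h
    refine ih hl.2 ?_
    have key := CliffordAlgebra.contractLeft_ι_mul (Q := (0 : QuadraticForm F (ℕ →₀ F)))
      (Finsupp.lapply i) (Finsupp.single i 1) (monomial F l)
    rw [contract i l hl.1, mul_zero, sub_zero, Finsupp.lapply_apply, Finsupp.single_eq_same,
      one_smul] at key
    rw [← key]
    rw [monomial_cons] at h
    exact (congrArg _ h).trans (map_zero _)

/-- The central elements `e_{2 * r + 2} e_{2 * r + 3}`. -/
noncomputable def pairGen (r : ℕ) : Subalgebra.center F (UnitalGrassmann F) :=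
  ⟨monomial F [2 * r + 2, 2 * r + 3], evenPart_le_center F
    (Submodule.subset_span ⟨_, by simp, by simp, rfl⟩)⟩

theorem pairGen_mul_self (r : ℕ) : pairGen F r * pairGen F r = 0 := by
  apply Subtype.ext
  change monomial F _ * monomial F _ = 0
  have h : monomial F [2 * r + 2, 2 * r + 3] = gen F (2 * r + 2) * gen F (2 * r + 3) := by
    simp [monomial]
  rw [h]
  rw [mul_assoc, ← mul_assoc (gen F (2 * r + 3)), gen_mul_gen F (2 * r + 3) (2 * r + 2), neg_mul,
    mul_assoc, gen_mul_self, mul_zero, neg_zero, mul_zero]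

/-- The sum of the elements `pairGen F (r + k)` over the positions `k` of `i` in the list. -/
noncomputable def pairSum : List ℕ → ℕ → ℕ → Subalgebra.center F (UnitalGrassmann F)
  | [], _, _ => 0
  | j :: l, r, i => (if i = j then pairGen F r else 0) + pairSum l (r + 1) i

/-- The product of the elements `pairGen F (r + k)` for `k < n`. -/
noncomputable def pairProd : ℕ → ℕ → Subalgebra.center F (UnitalGrassmann F)
  | 0, _ => 1
  | n + 1, r => pairGen F r * pairProd n (r + 1)

/-- As `p` has square zero, only the terms of degree at most one in `p` survive; the linear one
chooses an occurrence of `j` to contribute `p`. -/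
theorem prod_map_ite_add {A : Type*} [CommRing A] (p : A) (hp : p * p = 0) (j : ℕ) (t : ℕ → A)
    (m : Multiset ℕ) :
    (m.map fun i => (if i = j then p else 0) + t i).prod =
      (m.map t).prod + m.count j • (p * ((m.erase j).map t).prod) := by
  induction m using Multiset.induction with
  | empty => simp
  | cons i m ih =>
    rw [Multiset.map_cons, Multiset.prod_cons, ih, Multiset.map_cons, Multiset.prod_cons]
    by_cases h : i = j
    · subst h
      rw [if_pos rfl, Multiset.count_cons_self, Multiset.erase_cons_head, succ_nsmul]
      rcases Nat.eq_zero_or_pos (m.count i) with h0 | h0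
      · rw [h0, zero_smul]; ring
      · have hm : i ∈ m := Multiset.count_pos.1 h0
        have h1 : (m.map t).prod = t i * ((m.erase i).map t).prod := by
          rw [← Multiset.prod_cons, ← Multiset.map_cons, Multiset.cons_erase hm]
        rw [h1]
        simp only [nsmul_eq_mul]
        linear_combination (m.count i) * ((m.erase i).map t).prod * hp
    · rw [if_neg h, Multiset.count_cons_of_ne (Ne.symm h), Multiset.erase_cons_tail _ h,
        Multiset.map_cons, Multiset.prod_cons]
      simp only [nsmul_eq_mul]
      ring

/-- The products of `pairSum F l r` over multisets of at least as many elements as `l`. -/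
theorem prod_pairSum (l : List ℕ) (r : ℕ) (m : Multiset ℕ) (hm : l.length ≤ m.card) :
    (m ≠ l → (m.map (pairSum F l r)).prod = 0) ∧
      (m = l → ∃ c : ℕ, c ≠ 0 ∧ (m.map (pairSum F l r)).prod = c • pairProd F l.length r) := by
  induction l generalizing r m with
  | nil =>
    refine ⟨fun h => ?_, fun h => ⟨1, one_ne_zero, by simp [h, pairProd]⟩⟩
    obtain ⟨a, ha⟩ := Multiset.exists_mem_of_ne_zero h
    obtain ⟨m', rfl⟩ := Multiset.exists_cons_of_mem ha
    simp [pairSum]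
  | cons j l ih =>
    have hm' : l.length + 1 ≤ m.card := hm
    have expand : (m.map (pairSum F (j :: l) r)).prod =
        m.count j • (pairGen F r * ((m.erase j).map (pairSum F l (r + 1))).prod) := by
      -- The part free of `pairGen F r` has more factors than `l` has positions, so it vanishes by
      -- induction.
      have h0 : (m.map (pairSum F l (r + 1))).prod = 0 := by
        refine (ih (r + 1) m (by omega)).1 ?_
        rintro rfl
        simp at hm'
      rw [← zero_add (m.count j • _), ← h0]
      exact prod_map_ite_add _ (pairGen_mul_self F r) j _ m
    rw [expand]
    by_cases hj : j ∈ m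
    · have hc : l.length ≤ (m.erase j).card := by
        rw [Multiset.card_erase_of_mem hj, Nat.pred_eq_sub_one]; omega
      refine ⟨fun h => ?_, fun h => ?_⟩
      · rw [(ih (r + 1) _ hc).1, mul_zero, smul_zero]
        intro h'
        apply h
        rw [← Multiset.cons_erase hj, h', Multiset.cons_coe]
      · obtain ⟨c, hc0, hc1⟩ := (ih (r + 1) _ hc).2 (by rw [h]; simp)
        refine ⟨m.count j * c, mul_ne_zero (Multiset.count_ne_zero.2 hj) hc0, ?_⟩
        rw [hc1, mul_smul_comm, smul_smul]
        rfl
    · refine ⟨fun _ => by rw [Multiset.count_eq_zero_of_notMem hj, zero_smul], fun h => ?_⟩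
      exact absurd (by rw [h]; simp) hj

theorem pairProd_eq_monomial (n r : ℕ) :
    (pairProd F n r : UnitalGrassmann F) = monomial F (List.range' (2 * r + 2) (2 * n)) := by
  induction n generalizing r with
  | zero => simp [pairProd, monomial]
  | succ n ih =>
    have : List.range' (2 * r + 2) (2 * (n + 1)) =
        [2 * r + 2, 2 * r + 3] ++ List.range' (2 * (r + 1) + 2) (2 * n) := by
      rw [show 2 * (n + 1) = 2 * n + 1 + 1 by ring, List.range'_succ, List.range'_succ]
      rfl
    rw [this, monomial_append, ← ih]
    rfl

theorem pairProd_mul_ne_zero (n : ℕ) :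
    (pairProd F n 0 : UnitalGrassmann F) * (gen F 0 * gen F 1) ≠ 0 := by
  have h : gen F 0 * gen F 1 = monomial F [0, 1] := by simp [monomial]
  rw [pairProd_eq_monomial, h, ← monomial_append]
  refine monomial_ne_zero F ?_
  rw [List.nodup_append]
  refine ⟨List.nodup_range', by simp, ?_⟩
  intro a ha b hb
  rw [List.mem_range'_1] at ha
  simp at hb
  omega

variable {F}

/-- The products of the elements `pairSum F l 0` are linearly independent, even after
multiplication by two more generators. -/
theorem eq_zero_of_sum_pairSum_eq_zero [CharZero F] (u : Multiset ℕ →₀ F)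
    (hu : ∀ l : List ℕ, (u.sum fun m c =>
      c • (((m.map (pairSum F l 0)).prod : UnitalGrassmann F) * (gen F 0 * gen F 1))) = 0) :
    u = 0 := by
  by_contra hne
  -- Minimal cardinality is essential: `prod_pairSum` says nothing about multisets smaller than the
  -- list.
  obtain ⟨m₀, hm₀, hmin⟩ := u.support.exists_min_image Multiset.card
    (Finsupp.support_nonempty_iff.2 hne)
  have h := hu m₀.toList
  have hlen : m₀.toList.length = m₀.card := Multiset.length_toList m₀
  rw [Finsupp.sum, Finset.sum_eq_single m₀] at h
  · obtain ⟨c, hc, hprod⟩ := (prod_pairSum F m₀.toList 0 m₀ hlen.le).2 m₀.coe_toList.symm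
    rw [hprod] at h
    have h' : (u m₀ * c) • ((pairProd F m₀.toList.length 0 : UnitalGrassmann F) *
        (gen F 0 * gen F 1)) = 0 := by
      rw [← h, mul_smul]
      congr 1
      rw [Nat.cast_smul_eq_nsmul, ← smul_mul_assoc]
      rfl
    rcases smul_eq_zero.1 h' with h1 | h1
    · exact mul_ne_zero (Finsupp.mem_support_iff.1 hm₀) (Nat.cast_ne_zero.2 hc) h1
    · exact pairProd_mul_ne_zero F _ h1
  · intro m hm hmm
    rw [(prod_pairSum F m₀.toList 0 m (hlen.trans_le (hmin m hm))).1 (by simpa using hmm)]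
    simp
  · intro h0
    exact absurd hm₀ h0

end GrassmannFacts

/-! ### Formal differentiation over multisets and the relations between pairings -/

section Combinatorics

/-- The sum of `f k (m - k)` over the elements `k` of the multiset `m`. -/
def derivSum {A : Type*} [AddCommMonoid A] (f : ℕ → Multiset ℕ → A) (m : Multiset ℕ) : A :=
  (m.map fun k => f k (m.erase k)).sum

variable {A : Type*} [AddCommGroup A]

theorem derivSum_cons (f : ℕ → Multiset ℕ → A) (a : ℕ) (m : Multiset ℕ) :
    derivSum f (a ::ₘ m) = f a m + derivSum (fun k m' => f k (a ::ₘ m')) m := by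
  rw [derivSum, Multiset.map_cons, Multiset.sum_cons, Multiset.erase_cons_head, derivSum]
  congr 2
  refine Multiset.map_congr rfl fun k hk => ?_
  rw [Multiset.erase_cons_tail_of_mem hk]

theorem derivSum_add (f g : ℕ → Multiset ℕ → A) (m : Multiset ℕ) :
    derivSum (fun k m' => f k m' + g k m') m = derivSum f m + derivSum g m :=
  Multiset.sum_map_add

theorem derivSum_sub (f g : ℕ → Multiset ℕ → A) (m : Multiset ℕ) :
    derivSum (fun k m' => f k m' - g k m') m = derivSum f m - derivSum g m :=
  Multiset.sum_map_sub

/-- Euler's identity: removing a letter and putting it back counts the letters. -/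
theorem derivSum_comp_cons (F : Type*) [Field F] [Module F A] (g : Multiset ℕ → A)
    (m : Multiset ℕ) :
    derivSum (fun k m' => g (k ::ₘ m')) m = (m.card : F) • g m := by
  rw [derivSum, Multiset.map_congr rfl fun k hk => by rw [Multiset.cons_erase hk],
    Multiset.map_const', Multiset.sum_replicate, Nat.cast_smul_eq_nsmul]

variable {F : Type*} [Field F] [Module F A]

/-- Cartan's formula for Koszul and de Rham differentials on two-forms. Removing the displayed
letters `a` and `b` gives the summand 2; the other letters give the cardinality by the Jacobi
relation and Euler's identity. -/
theorem derivSum_sub_derivSum {w : ℕ → ℕ → Multiset ℕ → A}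
    (anti : ∀ a b m, w b a m = -w a b m)
    (jacobi : ∀ a b k m, w k b (a ::ₘ m) - w k a (b ::ₘ m) = w a b (k ::ₘ m))
    (a b : ℕ) (m : Multiset ℕ) :
    derivSum (fun k m' => w k b m') (a ::ₘ m) - derivSum (fun k m' => w k a m') (b ::ₘ m) =
      ((m.card : F) + 2) • w a b m := by
  have h : derivSum (fun k m' => w k b (a ::ₘ m')) m - derivSum (fun k m' => w k a (b ::ₘ m')) m =
      (m.card : F) • w a b m := by
    rw [← derivSum_sub, ← derivSum_comp_cons]
    simp only [jacobi]
  rw [derivSum_cons, derivSum_cons, anti a b]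
  linear_combination (norm := module) h

/-- The relations between the elements
`⁅[x a, x b, x k₁, …, x kₙ], ⁅x c, x d⁆⁆`, `m = {k₁, …, kₙ}`, of a center-by-metabelian
Lie algebra. -/
structure PairingRelations (F : Type*) [Field F] {A : Type*} [AddCommGroup A] [Module F A]
    (z : ℕ → ℕ → Multiset ℕ → ℕ → ℕ → A) : Prop where
  anti_left : ∀ a b m c d, z b a m c d = -z a b m c d
  anti_right : ∀ a b m c d, z a b m d c = -z a b m c d
  jacobi : ∀ a b k m c d, z k b (a ::ₘ m) c d - z k a (b ::ₘ m) c d = z a b (k ::ₘ m) c d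
  swap : ∀ a b m c d, z c d m a b = -(-1 : F) ^ m.card • z a b m c d

namespace PairingRelations

variable {z : ℕ → ℕ → Multiset ℕ → ℕ → ℕ → A}

/-- The Jacobi relation of the left factor, carried to the right one by `swap`; all three multisets
have the same size, so the signs agree. -/
theorem jacobi_right (h : PairingRelations F z) (a b k : ℕ) (m : Multiset ℕ) (c d : ℕ) :
    z a b (c ::ₘ m) k d - z a b (d ::ₘ m) k c = z a b (k ::ₘ m) c d := by
  rw [h.swap k d, h.swap k c, h.swap c d, ← h.jacobi c d k]
  simp only [Multiset.card_cons]
  module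

/-- For even size `swap` is antisymmetric and the terms cancel in pairs. For odd size it is
symmetric, and a Plücker-type relation between the three splittings of `a, b, c, d` leaves twice the
original pairing. -/
theorem alternating_sum [CharZero F] (h : PairingRelations F z) (a b : ℕ) (m : Multiset ℕ)
    (c d : ℕ) :
    z c b m a d - z d b m a c - z c a m b d + z d a m b c =
      (1 - (-1 : F) ^ m.card) • z a b m c d := by
  have s1 := h.swap a b m c d
  have s2 := h.swap a c m b d
  have s3 := h.swap a d m b c
  have a1 := h.anti_left b c m a d
  have a2 := h.anti_left b d m a c
  have a3 := h.anti_left a c m b d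
  have a4 := h.anti_left a d m b c
  rw [a1, a2, a3, a4]
  rcases Nat.even_or_odd m.card with hm | hm
  · rw [hm.neg_one_pow] at s1 s2 s3 ⊢
    rw [s2, s3]
    module
  · rw [hm.neg_one_pow] at s1 s2 s3 ⊢
    -- Odd size supplies a letter `e`; expanding all six pairings along it by the Jacobi relation
    -- makes their signed sum cancel.
    obtain ⟨e, he⟩ : ∃ e, e ∈ m := Multiset.card_pos_iff_exists_mem.1 hm.pos
    obtain ⟨m, rfl⟩ := Multiset.exists_cons_of_mem he
    have total : z a b (e ::ₘ m) c d - z a c (e ::ₘ m) b d + z a d (e ::ₘ m) b c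
        + z c d (e ::ₘ m) a b - z b d (e ::ₘ m) a c + z b c (e ::ₘ m) a d = 0 := by
      rw [← h.jacobi a b e, ← h.jacobi a c e, ← h.jacobi a d e, ← h.jacobi c d e,
        ← h.jacobi b d e, ← h.jacobi b c e]
      have ja := h.jacobi_right e a b m c d
      have jb := h.jacobi_right e b a m c d
      have jc := h.jacobi_right e c a m b d
      have jd := h.jacobi_right e d a m b c
      linear_combination (norm := module) ja - jb + jc - jd
    rw [s1, s2, s3] at total
    have half : (2 : F) • (z a b (e ::ₘ m) c d - z a c (e ::ₘ m) b d + z a d (e ::ₘ m) b c) = 0 := by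
      linear_combination (norm := module) total
    rw [smul_eq_zero_iff_right (two_ne_zero)] at half
    rw [s2, s3]
    linear_combination (norm := module) (-2 : F) • half

/-- A second order differential operator with values in the span of the `z a b m c d`. -/
def secondSum (z : ℕ → ℕ → Multiset ℕ → ℕ → ℕ → A) (i j : ℕ) (m : Multiset ℕ) : A :=
  derivSum (fun k m' => derivSum (fun l m'' => z k i m'' l j) m') m

theorem secondSum_cons_cons (z : ℕ → ℕ → Multiset ℕ → ℕ → ℕ → A) (i j p q : ℕ)
    (m : Multiset ℕ) :
    secondSum z i j (p ::ₘ q ::ₘ m) =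
      z p i m q j + z q i m p j
        + derivSum (fun l m' => z p i (q ::ₘ m') l j) m
        + derivSum (fun l m' => z q i (p ::ₘ m') l j) m
        + derivSum (fun k m' => z k i (q ::ₘ m') p j) m
        + derivSum (fun k m' => z k i (p ::ₘ m') q j) m
        + derivSum (fun k m' => derivSum (fun l m'' => z k i (p ::ₘ q ::ₘ m'') l j) m') m := by
  simp only [secondSum, derivSum_cons, derivSum_add]
  abel

/-- With `n` the cardinality: removing two displayed letters gives `4 + (1 - (-1)^n)`, the last part
by `alternating_sum`; removing one displayed letter gives `6n`; removing none gives `n(n - 1)`. -/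
theorem secondSum_alternating [CharZero F] (h : PairingRelations F z) (a b : ℕ) (m : Multiset ℕ)
    (c d : ℕ) :
    secondSum z b d (a ::ₘ c ::ₘ m) - secondSum z b c (a ::ₘ d ::ₘ m)
        - secondSum z a d (b ::ₘ c ::ₘ m) + secondSum z a c (b ::ₘ d ::ₘ m) =
      ((m.card : F) ^ 2 + 5 * m.card + 5 - (-1) ^ m.card) • z a b m c d := by
  have right : ∀ a b, derivSum (fun l m' => z a b (c ::ₘ m') l d) m
      - derivSum (fun l m' => z a b (d ::ₘ m') l c) m = (m.card : F) • z a b m c d := by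
    intro a b
    rw [← derivSum_sub, ← derivSum_comp_cons F (fun y => z a b y c d)]
    simp only [h.jacobi_right]
  have left : ∀ c d, derivSum (fun k m' => z k b (a ::ₘ m') c d) m
      - derivSum (fun k m' => z k a (b ::ₘ m') c d) m = (m.card : F) • z a b m c d := by
    intro c d
    rw [← derivSum_sub, ← derivSum_comp_cons F (fun y => z a b y c d)]
    simp only [h.jacobi]
  have mixed₁ : derivSum (fun l m' => z c b (a ::ₘ m') l d) m
      - derivSum (fun l m' => z d b (a ::ₘ m') l c) m
      - derivSum (fun l m' => z c a (b ::ₘ m') l d) m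
      + derivSum (fun l m' => z d a (b ::ₘ m') l c) m = (m.card : F) • z a b m c d := by
    rw [← right, ← derivSum_sub, ← derivSum_sub, ← derivSum_sub, ← derivSum_add]
    congr
    funext l m'
    rw [← h.jacobi a b c, ← h.jacobi a b d]
    abel
  have mixed₂ : derivSum (fun k m' => z k b (c ::ₘ m') a d) m
      - derivSum (fun k m' => z k b (d ::ₘ m') a c) m
      - derivSum (fun k m' => z k a (c ::ₘ m') b d) m
      + derivSum (fun k m' => z k a (d ::ₘ m') b c) m = (m.card : F) • z a b m c d := by
    rw [← left, ← derivSum_sub, ← derivSum_sub, ← derivSum_sub, ← derivSum_add]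
    congr
    funext l m'
    rw [← h.jacobi_right l b a, ← h.jacobi_right l a b]
    abel
  have double : derivSum (fun k m' => derivSum (fun l m'' => z k b (a ::ₘ c ::ₘ m'') l d) m') m
      - derivSum (fun k m' => derivSum (fun l m'' => z k b (a ::ₘ d ::ₘ m'') l c) m') m
      - derivSum (fun k m' => derivSum (fun l m'' => z k a (b ::ₘ c ::ₘ m'') l d) m') m
      + derivSum (fun k m' => derivSum (fun l m'' => z k a (b ::ₘ d ::ₘ m'') l c) m') m =
      (m.card * (m.card - 1) : F) • z a b m c d := by
    rw [mul_smul, ← derivSum_comp_cons F (fun y => ((y.card : F) - 1) • z a b y c d),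
      ← derivSum_sub, ← derivSum_sub, ← derivSum_add]
    congr
    funext k m'
    rw [← derivSum_sub, ← derivSum_sub, ← derivSum_add, Multiset.card_cons, Nat.cast_add,
      Nat.cast_one, add_sub_cancel_right, ← derivSum_comp_cons F (fun y => z a b (k ::ₘ y) c d)]
    congr
    funext l m''
    rw [Multiset.cons_swap k l, ← h.jacobi_right a b l, Multiset.cons_swap c k,
      Multiset.cons_swap d k, ← h.jacobi a b k (c ::ₘ m''), ← h.jacobi a b k (d ::ₘ m'')]
    abel
  have outer := h.alternating_sum a b m c d
  have r₁ := right a b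
  have r₂ := right b a
  have l₁ := left c d
  have l₂ := left d c
  have e₁ := h.anti_left a b m c d
  have e₂ := h.anti_right a b m c d
  have e₃ := h.anti_right b a m c d
  rw [e₁] at e₃ r₂
  rw [e₂] at l₂
  simp only [secondSum_cons_cons]
  rw [e₁, e₂, e₃]
  linear_combination (norm := module) outer + r₁ - r₂ + mixed₁ + mixed₂ + l₁ - l₂ + double

end PairingRelations

end Combinatorics

/-! ### Spanning sets and relations in center-by-metabelian Lie algebras -/

section CenterByMetabelian

variable (F : Type*) [Field F] (K : Type*) [LieRing K] [LieAlgebra F K]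

/-- The second derived algebra is central. -/
def IsCenterByMetabelian : Prop :=
  ∀ a b c d e : K, ⁅⁅⁅a, b⁆, ⁅c, d⁆⁆, e⁆ = 0

/-- The span of all brackets. -/
def derived : Submodule F K :=
  Submodule.span F {u | ∃ a b : K, u = ⁅a, b⁆}

/-- The span of the brackets of elements of `derived F K`. -/
def secondDerived : Submodule F K :=
  Submodule.span F {s | ∃ u ∈ derived F K, ∃ v ∈ derived F K, s = ⁅u, v⁆}

variable {F K}

theorem lie_mem_derived (a b : K) : ⁅a, b⁆ ∈ derived F K :=
  Submodule.subset_span ⟨a, b, rfl⟩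

theorem lie_mem_secondDerived {u v : K} (hu : u ∈ derived F K) (hv : v ∈ derived F K) :
    ⁅u, v⁆ ∈ secondDerived F K :=
  Submodule.subset_span ⟨u, hu, v, hv, rfl⟩

/-- An induction principle for membership of brackets of elements of a span. -/
theorem lie_mem_of_mem_span {S T : Set K} {N : Submodule F K}
    (h : ∀ s ∈ S, ∀ t ∈ T, ⁅s, t⁆ ∈ N) {u v : K}
    (hu : u ∈ Submodule.span F S) (hv : v ∈ Submodule.span F T) : ⁅u, v⁆ ∈ N := by
  induction hu, hv using Submodule.span_induction₂ with
  | mem_mem x y hx hy => exact h x hx y hy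
  | zero_left y hy => simp
  | zero_right x hx => simp
  | add_left x y z _ _ _ h1 h2 => rw [add_lie]; exact add_mem h1 h2
  | add_right x y z _ _ _ h1 h2 => rw [lie_add]; exact add_mem h1 h2
  | smul_left r x y _ _ h => rw [smul_lie]; exact N.smul_mem r h
  | smul_right r x y _ _ h => rw [lie_smul]; exact N.smul_mem r h

theorem lie_eq_zero_of_mem_secondDerived (hK : IsCenterByMetabelian K) {s : K}
    (hs : s ∈ secondDerived F K) (e : K) : ⁅s, e⁆ = 0 := by
  have base : ∀ u ∈ derived F K, ∀ v ∈ derived F K, ⁅⁅u, v⁆, e⁆ = 0 := by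
    intro u hu v hv
    rw [derived] at hu hv
    induction hu, hv using Submodule.span_induction₂ with
    | mem_mem x y hx hy =>
      obtain ⟨a, b, rfl⟩ := hx
      obtain ⟨c, d, rfl⟩ := hy
      exact hK a b c d e
    | zero_left y hy => simp
    | zero_right x hx => simp
    | add_left x y z _ _ _ h1 h2 => rw [add_lie, add_lie, h1, h2, add_zero]
    | add_right x y z _ _ _ h1 h2 => rw [lie_add, add_lie, h1, h2, add_zero]
    | smul_left r x y _ _ h => rw [smul_lie, smul_lie, h, smul_zero]
    | smul_right r x y _ _ h => rw [lie_smul, smul_lie, h, smul_zero]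
  rw [secondDerived] at hs
  induction hs using Submodule.span_induction with
  | mem s h =>
    obtain ⟨u, hu, v, hv, rfl⟩ := h
    exact base u hu v hv
  | zero => simp
  | add x y _ _ h1 h2 => rw [add_lie, h1, h2, add_zero]
  | smul r x _ h => rw [smul_lie, h, smul_zero]

theorem lie_eq_lie_of_sub_mem (hK : IsCenterByMetabelian K) {u v : K}
    (h : u - v ∈ secondDerived F K) (e : K) : ⁅u, e⁆ = ⁅v, e⁆ := by
  rw [← sub_eq_zero, ← sub_lie, lie_eq_zero_of_mem_secondDerived hK h]

/-- The bracket with `y` on the right. -/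
def lieRight (F : Type*) [Field F] {K : Type*} [LieRing K] [LieAlgebra F K] (y : K) :
    K →ₗ[F] K where
  toFun u := ⁅u, y⁆
  map_add' u v := add_lie u v y
  map_smul' r u := smul_lie r u y

variable (F) in
/-- The left-normed bracket of `u` with the `x i`, `i ∈ l`, the head of `l` acting last. -/
def act (x : ℕ → K) : List ℕ → K →ₗ[F] K
  | [] => LinearMap.id
  | i :: l => lieRight F (x i) ∘ₗ act x l

variable (x : ℕ → K)

theorem act_nil (u : K) : act F x [] u = u := rfl

theorem act_cons (i : ℕ) (l : List ℕ) (u : K) : act F x (i :: l) u = ⁅act F x l u, x i⁆ := rfl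

theorem act_append (l l' : List ℕ) (u : K) :
    act F x (l ++ l') u = act F x l (act F x l' u) := by
  induction l with
  | nil => rfl
  | cons i l ih => rw [List.cons_append, act_cons, act_cons, ih]

theorem act_mem_derived (l : List ℕ) {u : K} (hu : u ∈ derived F K) :
    act F x l u ∈ derived F K := by
  cases l with
  | nil => exact hu
  | cons i l => exact lie_mem_derived _ _

theorem act_sub_act_mem (hK : IsCenterByMetabelian K) {l l' : List ℕ} (h : l.Perm l') {u : K}
    (hu : u ∈ derived F K) : act F x l u - act F x l' u ∈ secondDerived F K := by
  induction h with
  | nil => simp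
  | @cons i l l' h ih =>
    -- The difference of the tails is central, so one further bracket removes it altogether.
    rw [act_cons, act_cons, lie_eq_lie_of_sub_mem hK ih, sub_self]
    exact zero_mem _
  | swap i j l =>
    simp only [act_cons]
    have : ⁅⁅act F x l u, x i⁆, x j⁆ - ⁅⁅act F x l u, x j⁆, x i⁆ = ⁅act F x l u, ⁅x i, x j⁆⁆ := by
      rw [leibniz_lie (act F x l u), ← lie_skew (x i) ⁅act F x l u, x j⁆]
      abel
    rw [this]
    exact lie_mem_secondDerived (act_mem_derived x l hu) (lie_mem_derived _ _)
  | trans _ _ h1 h2 => simpa using add_mem h1 h2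

theorem act_lie_sub_mem (hK : IsCenterByMetabelian K) (l : List ℕ) (i : ℕ) {u : K}
    (hu : u ∈ derived F K) :
    act F x (i :: l) u - act F x l ⁅u, x i⁆ ∈ secondDerived F K := by
  have h := act_sub_act_mem x hK (List.perm_append_singleton i l).symm hu
  rwa [act_append] at h

/-- Since `⁅u, v⁆` is central, `⁅⁅u, v⁆, x i⁆ = 0`, so by the Leibniz rule a letter crosses the
bracket at the cost of a sign. The order in which the letters arrive is immaterial modulo the second
derived algebra. -/
theorem lie_act_left (hK : IsCenterByMetabelian K) (l : List ℕ) {u v : K}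
    (hu : u ∈ derived F K) (hv : v ∈ derived F K) :
    ⁅act F x l u, v⁆ = (-1 : F) ^ l.length • ⁅u, act F x l v⁆ := by
  induction l generalizing v with
  | nil => simp [act_nil]
  | cons i l ih =>
    have h0 : ⁅⁅act F x l u, v⁆, x i⁆ = 0 := lie_eq_zero_of_mem_secondDerived (F := F) hK
      (lie_mem_secondDerived (act_mem_derived x l hu) hv) _
    have h1 : ⁅⁅act F x l u, x i⁆, v⁆ = -⁅act F x l u, ⁅v, x i⁆⁆ := by
      rw [leibniz_lie (act F x l u), h0, ← lie_skew v]
      abel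
    have h2 : ⁅act F x (i :: l) v, u⁆ = ⁅act F x l ⁅v, x i⁆, u⁆ :=
      lie_eq_lie_of_sub_mem hK (act_lie_sub_mem x hK l i hv) u
    rw [act_cons, h1, ih (lie_mem_derived _ _), ← lie_skew u, ← h2, lie_skew, List.length_cons,
      pow_succ, mul_neg_one, neg_smul]

variable (F) in
/-- The class of `[x a, x b, x k₁, …, x kₙ]` modulo the second derived algebra, where
`m = {k₁, …, kₙ}`. -/
noncomputable def word (a b : ℕ) (m : Multiset ℕ) : K ⧸ secondDerived F K :=
  (secondDerived F K).mkQ (act F x m.toList ⁅x a, x b⁆)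

variable (F) in
/-- The element `⁅[x a, x b, x k₁, …, x kₙ], ⁅x c, x d⁆⁆`, where `m = {k₁, …, kₙ}`. -/
noncomputable def pairing (a b : ℕ) (m : Multiset ℕ) (c d : ℕ) : K :=
  ⁅act F x m.toList ⁅x a, x b⁆, ⁅x c, x d⁆⁆

theorem coe_toList_perm (l : List ℕ) : (l : Multiset ℕ).toList.Perm l :=
  Multiset.coe_eq_coe.1 (Multiset.coe_toList _)

theorem toList_cons_perm (i : ℕ) (m : Multiset ℕ) : (i ::ₘ m).toList.Perm (i :: m.toList) := by
  rw [← Multiset.coe_eq_coe, Multiset.coe_toList, ← Multiset.cons_coe, Multiset.coe_toList]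

theorem word_coe (hK : IsCenterByMetabelian K) (a b : ℕ) (l : List ℕ) :
    word F x a b l = (secondDerived F K).mkQ (act F x l ⁅x a, x b⁆) := by
  rw [word, ← sub_eq_zero, ← map_sub, Submodule.mkQ_apply, Submodule.Quotient.mk_eq_zero]
  exact act_sub_act_mem x hK (coe_toList_perm l) (lie_mem_derived _ _)

theorem pairing_coe (hK : IsCenterByMetabelian K) (a b : ℕ) (l : List ℕ) (c d : ℕ) :
    pairing F x a b l c d = ⁅act F x l ⁅x a, x b⁆, ⁅x c, x d⁆⁆ :=
  lie_eq_lie_of_sub_mem hK (act_sub_act_mem x hK (coe_toList_perm l) (lie_mem_derived _ _)) _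

theorem word_anti (a b : ℕ) (m : Multiset ℕ) : word F x b a m = -word F x a b m := by
  rw [word, word, ← lie_skew (x b), map_neg, map_neg]

theorem jacobi_sub_mem (hK : IsCenterByMetabelian K) (a b k : ℕ) (m : Multiset ℕ) :
    act F x (a ::ₘ m).toList ⁅x k, x b⁆ - act F x (b ::ₘ m).toList ⁅x k, x a⁆ -
      act F x (k ::ₘ m).toList ⁅x a, x b⁆ ∈ secondDerived F K := by
  have step : ∀ i u, u ∈ derived F K →
      act F x (i ::ₘ m).toList u - act F x m.toList ⁅u, x i⁆ ∈ secondDerived F K := by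
    intro i u hu
    have h := add_mem (act_sub_act_mem x hK (toList_cons_perm i m) hu)
      (act_lie_sub_mem x hK m.toList i hu)
    rwa [sub_add_sub_cancel] at h
  have h1 := step a _ (lie_mem_derived (x k) (x b))
  have h2 := step b _ (lie_mem_derived (x k) (x a))
  have h3 := step k _ (lie_mem_derived (x a) (x b))
  have h4 : ⁅⁅x k, x b⁆, x a⁆ - ⁅⁅x k, x a⁆, x b⁆ - ⁅⁅x a, x b⁆, x k⁆ = 0 := by
    rw [← lie_skew ⁅x k, x b⁆ (x a), ← lie_skew ⁅x a, x b⁆ (x k), leibniz_lie (x k) (x a) (x b)]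
    abel
  have h5 := congrArg (act F x m.toList) h4
  rw [map_sub, map_sub, map_zero] at h5
  have h6 := sub_mem (sub_mem h1 h2) h3
  rwa [show ∀ p q r p' q' r' : K, p - p' - (q - q') - (r - r') = p - q - r - (p' - q' - r') from
    fun _ _ _ _ _ _ => by abel, h5, sub_zero] at h6

theorem word_jacobi (hK : IsCenterByMetabelian K) (a b k : ℕ) (m : Multiset ℕ) :
    word F x k b (a ::ₘ m) - word F x k a (b ::ₘ m) = word F x a b (k ::ₘ m) := by
  rw [← sub_eq_zero, word, word, word, ← map_sub, ← map_sub, Submodule.mkQ_apply,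
    Submodule.Quotient.mk_eq_zero]
  exact jacobi_sub_mem x hK a b k m

theorem pairingRelations (hK : IsCenterByMetabelian K) :
    PairingRelations F (pairing F x) where
  anti_left a b m c d := by rw [pairing, pairing, ← lie_skew (x b), map_neg, neg_lie]
  anti_right a b m c d := by rw [pairing, pairing, ← lie_skew (x d), lie_neg]
  jacobi a b k m c d := by
    rw [← sub_eq_zero, pairing, pairing, pairing, ← sub_lie, ← sub_lie]
    exact lie_eq_zero_of_mem_secondDerived hK (jacobi_sub_mem x hK a b k m) _
  swap a b m c d := by
    rw [pairing, pairing, lie_act_left x hK _ (lie_mem_derived _ _) (lie_mem_derived _ _),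
      ← lie_skew, Multiset.length_toList, smul_neg, neg_smul]

variable (F) in
/-- The left-normed brackets of length at least two in the elements `x i`. -/
def leftNormed : Set K := {u | ∃ a b l, u = act F x l ⁅x a, x b⁆}

theorem leftNormed_subset_derived : leftNormed F x ⊆ derived F K := by
  rintro _ ⟨a, b, l, rfl⟩
  exact act_mem_derived x l (lie_mem_derived _ _)

theorem lie_mem_span_leftNormed (hK : IsCenterByMetabelian K) {u v : K}
    (hu : u ∈ Submodule.span F (Set.range x ∪ (leftNormed F x ∪ secondDerived F K)))
    (hv : v ∈ Submodule.span F (Set.range x ∪ (leftNormed F x ∪ secondDerived F K))) :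
    ⁅u, v⁆ ∈ Submodule.span F (leftNormed F x ∪ secondDerived F K) := by
  refine lie_mem_of_mem_span ?_ hu hv
  rintro s hs t ht
  have central : ∀ s ∈ secondDerived F K, ∀ t : K, ⁅s, t⁆ = 0 := fun s hs t =>
    lie_eq_zero_of_mem_secondDerived hK hs t
  have hright : t ∈ secondDerived F K → ⁅s, t⁆ = 0 := fun h => by
    rw [← lie_skew, central t h, neg_zero]
  rcases hs with ⟨a, rfl⟩ | hs | hs
  · rcases ht with ⟨b, rfl⟩ | ⟨c, d, l, rfl⟩ | ht
    · exact Submodule.subset_span (Or.inl ⟨a, b, [], rfl⟩)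
    · rw [← lie_skew]
      exact neg_mem (Submodule.subset_span (Or.inl ⟨c, d, a :: l, rfl⟩))
    · rw [hright ht]; exact zero_mem _
  · rcases ht with ⟨b, rfl⟩ | ht | ht
    · obtain ⟨c, d, l, rfl⟩ := hs
      exact Submodule.subset_span (Or.inl ⟨c, d, b :: l, rfl⟩)
    · exact Submodule.subset_span (Or.inr (lie_mem_secondDerived
        (leftNormed_subset_derived x hs) (leftNormed_subset_derived x ht)))
    · rw [hright ht]; exact zero_mem _
  · rw [central s hs]; exact zero_mem _

/-- A center-by-metabelian Lie algebra is spanned by its generators, their left-normed brackets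
and the second derived algebra. -/
theorem mem_span_leftNormed (hK : IsCenterByMetabelian K)
    (hx : ∀ S : LieSubalgebra F K, Set.range x ⊆ S → S = ⊤) (u : K) :
    u ∈ Submodule.span F (Set.range x ∪ (leftNormed F x ∪ secondDerived F K)) := by
  let S : LieSubalgebra F K :=
    { Submodule.span F (Set.range x ∪ (leftNormed F x ∪ secondDerived F K)) with
      lie_mem' := fun hu hv => Submodule.span_mono Set.subset_union_right
        (lie_mem_span_leftNormed x hK hu hv) }
  have hS : S = ⊤ := hx S fun y hy => Submodule.subset_span (Or.inl hy)
  have : u ∈ S := hS ▸ LieSubalgebra.mem_top u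
  exact this

theorem derived_le_span (hK : IsCenterByMetabelian K)
    (hx : ∀ S : LieSubalgebra F K, Set.range x ⊆ S → S = ⊤) :
    derived F K ≤ Submodule.span F (leftNormed F x ∪ secondDerived F K) := by
  refine Submodule.span_le.2 ?_
  rintro _ ⟨a, b, rfl⟩
  exact lie_mem_span_leftNormed x hK (mem_span_leftNormed x hK hx a)
    (mem_span_leftNormed x hK hx b)

/-- All letters of the right-hand word can be moved to the left one, so only a bracket of two
generators remains on the right. -/
theorem secondDerived_le_span (hK : IsCenterByMetabelian K)
    (hx : ∀ S : LieSubalgebra F K, Set.range x ⊆ S → S = ⊤) :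
    secondDerived F K ≤ Submodule.span F
      {s | ∃ a b, ∃ l : List ℕ, ∃ c d, s = pairing F x a b l c d} := by
  refine Submodule.span_le.2 ?_
  rintro _ ⟨u, hu, v, hv, rfl⟩
  refine lie_mem_of_mem_span ?_ (derived_le_span x hK hx hu) (derived_le_span x hK hx hv)
  rintro s hs t ht
  rcases hs with ⟨a, b, l, rfl⟩ | hs
  · rcases ht with ⟨c, d, l', rfl⟩ | ht
    · have h := lie_act_left x hK l' (act_mem_derived x l (lie_mem_derived (F := F) (x a) (x b)))
        (lie_mem_derived (x c) (x d))
      have h' : ⁅act F x l ⁅x a, x b⁆, act F x l' ⁅x c, x d⁆⁆ =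
          (-1 : F) ^ l'.length • pairing F x a b (l' ++ l : List ℕ) c d := by
        rw [pairing_coe x hK, act_append, h, smul_smul, ← mul_pow, neg_one_mul, neg_neg, one_pow,
          one_smul]
      rw [h']
      exact Submodule.smul_mem _ _ (Submodule.subset_span ⟨a, b, _, c, d, rfl⟩)
    · rw [← lie_skew, lie_eq_zero_of_mem_secondDerived hK ht, neg_zero]
      exact zero_mem _
  · rw [lie_eq_zero_of_mem_secondDerived hK hs]
    exact zero_mem _

end CenterByMetabelian

/-! ### Matrix entries of words and pairings -/

section Evaluation

attribute [local instance 100] LieRing.ofAssociativeRing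

variable {F : Type*} [Field F]

theorem coe_lie_apply (A B : lieM11 F) (i j : Fin 2) :
    (⁅A, B⁆ : lieM11 F).1 i j =
      A.1 i 0 * B.1 0 j + A.1 i 1 * B.1 1 j - (B.1 i 0 * A.1 0 j + B.1 i 1 * A.1 1 j) := by
  rw [LieSubalgebra.coe_bracket, LieRing.of_associative_ring_bracket, Matrix.sub_apply,
    Matrix.mul_apply, Matrix.mul_apply, Fin.sum_univ_two, Fin.sum_univ_two]

theorem lie_apply_zero_zero (A B : lieM11 F) :
    (⁅A, B⁆ : lieM11 F).1 0 0 = A.1 0 1 * B.1 1 0 - B.1 0 1 * A.1 1 0 := by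
  rw [coe_lie_apply, evenPart_commute F A.2.1 (B.1 0 0)]
  abel

theorem lie_apply_one_one (A B : lieM11 F) :
    (⁅A, B⁆ : lieM11 F).1 1 1 = A.1 0 1 * B.1 1 0 - B.1 0 1 * A.1 1 0 := by
  rw [coe_lie_apply, evenPart_commute F A.2.2.1 (B.1 1 1),
    oddPart_anticommute F A.2.2.2.2 B.2.2.2.1, oddPart_anticommute F B.2.2.2.2 A.2.2.2.1]
  abel

theorem lie_apply_zero_one (A B : lieM11 F) :
    (⁅A, B⁆ : lieM11 F).1 0 1 =
      (A.1 0 0 - A.1 1 1) * B.1 0 1 - (B.1 0 0 - B.1 1 1) * A.1 0 1 := by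
  rw [coe_lie_apply, evenPart_commute F B.2.2.1 (A.1 0 1),
    evenPart_commute F A.2.2.1 (B.1 0 1), sub_mul, sub_mul]
  abel

theorem lie_apply_one_zero (A B : lieM11 F) :
    (⁅A, B⁆ : lieM11 F).1 1 0 =
      -((A.1 0 0 - A.1 1 1) * B.1 1 0 - (B.1 0 0 - B.1 1 1) * A.1 1 0) := by
  rw [coe_lie_apply, evenPart_commute F B.2.1 (A.1 1 0),
    evenPart_commute F A.2.1 (B.1 1 0), sub_mul, sub_mul]
  abel

theorem lieM11_ext {A B : lieM11 F} (h00 : A.1 0 0 = B.1 0 0) (h01 : A.1 0 1 = B.1 0 1)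
    (h10 : A.1 1 0 = B.1 1 0) (h11 : A.1 1 1 = B.1 1 1) : A = B := by
  apply Subtype.ext
  ext i j
  fin_cases i <;> fin_cases j <;> assumption

variable (F) in
-- The off-diagonal entries of a bracket see the diagonals only through their differences, which
-- vanish for brackets. So a double bracket has zero off-diagonal entries and equal diagonal ones.
theorem isCenterByMetabelian_lieM11 : IsCenterByMetabelian (lieM11 F) := by
  intro a b c d e
  have diag : ∀ A B : lieM11 F,
      (⁅A, B⁆ : lieM11 F).1 0 0 - (⁅A, B⁆ : lieM11 F).1 1 1 = 0 := fun A B => by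
    rw [lie_apply_zero_zero, lie_apply_one_one, sub_self]
  have h01 : (⁅⁅a, b⁆, ⁅c, d⁆⁆ : lieM11 F).1 0 1 = 0 := by
    rw [lie_apply_zero_one, diag, diag, zero_mul, zero_mul, sub_zero]
  have h10 : (⁅⁅a, b⁆, ⁅c, d⁆⁆ : lieM11 F).1 1 0 = 0 := by
    rw [lie_apply_one_zero, diag, diag, zero_mul, zero_mul, sub_zero, neg_zero]
  apply lieM11_ext
  · rw [lie_apply_zero_zero, h01, h10, zero_mul, mul_zero, sub_zero]; rfl
  · rw [lie_apply_zero_one, diag, h01, zero_mul, mul_zero, sub_zero]; rfl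
  · rw [lie_apply_one_zero, diag, h10, zero_mul, mul_zero, sub_zero, neg_zero]; rfl
  · rw [lie_apply_one_one, h01, h10, zero_mul, mul_zero, sub_zero]; rfl

/-- The difference of the diagonal entries. -/
noncomputable def weight (A : lieM11 F) : Subalgebra.center F (UnitalGrassmann F) :=
  ⟨A.1 0 0 - A.1 1 1, evenPart_le_center F (sub_mem A.2.1 A.2.2.1)⟩

/-- The product of the weights of the `A i`, `i ∈ m`. -/
noncomputable def weightProd (A : ℕ → lieM11 F) (m : Multiset ℕ) : UnitalGrassmann F :=
  ((m.map fun i => weight (A i)).prod : Subalgebra.center F (UnitalGrassmann F))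

theorem weightProd_zero (A : ℕ → lieM11 F) : weightProd A 0 = 1 := by
  simp [weightProd]

theorem weightProd_cons (A : ℕ → lieM11 F) (i : ℕ) (m : Multiset ℕ) :
    weightProd A (i ::ₘ m) = weight (A i) * weightProd A m := by
  simp [weightProd]

theorem weight_commute (A : lieM11 F) (y : UnitalGrassmann F) :
    y * (weight A : UnitalGrassmann F) = weight A * y :=
  (Subalgebra.mem_center_iff (R := F)).1 (weight A).2 y

theorem act_apply_diag (A : ℕ → lieM11 F) (l : List ℕ) {U : lieM11 F} (hU : U.1 0 0 = U.1 1 1) :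
    (act F A l U).1 0 0 = (act F A l U).1 1 1 := by
  cases l with
  | nil => exact hU
  | cons i l => rw [act_cons, lie_apply_zero_zero, lie_apply_one_one]

theorem act_apply_zero_one (A : ℕ → lieM11 F) (l : List ℕ) {U : lieM11 F}
    (hU : U.1 0 0 = U.1 1 1) :
    (act F A l U).1 0 1 = (-1 : F) ^ l.length • (weightProd A l * U.1 0 1) := by
  induction l with
  | nil => simp [act_nil, weightProd_zero]
  | cons i l ih =>
    rw [act_cons, lie_apply_zero_one, act_apply_diag A l hU, sub_self, zero_mul, zero_sub, ih,
      ← Multiset.cons_coe, weightProd_cons, List.length_cons, pow_succ, mul_neg_one, neg_smul,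
      mul_smul_comm, mul_assoc]
    rfl

theorem act_apply_one_zero (A : ℕ → lieM11 F) (l : List ℕ) {U : lieM11 F}
    (hU : U.1 0 0 = U.1 1 1) :
    (act F A l U).1 1 0 = weightProd A l * U.1 1 0 := by
  induction l with
  | nil => simp [act_nil, weightProd_zero]
  | cons i l ih =>
    rw [act_cons, lie_apply_one_zero, act_apply_diag A l hU, sub_self, zero_mul, zero_sub, ih,
      ← Multiset.cons_coe, weightProd_cons, neg_neg, mul_assoc]
    rfl

theorem lie_diag (A B : lieM11 F) : (⁅A, B⁆ : lieM11 F).1 0 0 = (⁅A, B⁆ : lieM11 F).1 1 1 := by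
  rw [lie_apply_zero_zero, lie_apply_one_one]

/-- The upper right entry of a left-normed bracket. -/
theorem leftNormed_apply_zero_one (A : ℕ → lieM11 F) (a b : ℕ) (l : List ℕ) :
    (act F A l ⁅A a, A b⁆).1 0 1 = (-1 : F) ^ l.length •
      (weightProd A (a ::ₘ l) * (A b).1 0 1 - weightProd A (b ::ₘ l) * (A a).1 0 1) := by
  rw [act_apply_zero_one A l (lie_diag _ _), lie_apply_zero_one, weightProd_cons, weightProd_cons,
    mul_sub, ← mul_assoc, ← mul_assoc]
  change _ • (_ * (weight (A a)).1 * _ - _ * (weight (A b)).1 * _) = _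
  rw [weight_commute, weight_commute]

theorem lie_leftNormed_apply_zero_one (A : ℕ → lieM11 F) (a b : ℕ) (l : List ℕ) (c d : ℕ) :
    (⁅act F A l ⁅A a, A b⁆, ⁅A c, A d⁆⁆ : lieM11 F).1 0 1 = 0 := by
  rw [lie_apply_zero_one, act_apply_diag A l (lie_diag _ _), lie_diag, sub_self, sub_self, zero_mul,
    zero_mul, sub_zero]

/-- The contribution of a multiset and two indices to the diagonal entries. -/
noncomputable def cross (A : ℕ → lieM11 F) (i j : ℕ) (m : Multiset ℕ) : UnitalGrassmann F :=
  weightProd A m * ((A i).1 0 1 * (A j).1 1 0)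

theorem lie_leftNormed_apply_zero_zero (A : ℕ → lieM11 F) (a b : ℕ) (l : List ℕ) (c d : ℕ) :
    (⁅act F A l ⁅A a, A b⁆, ⁅A c, A d⁆⁆ : lieM11 F).1 0 0 =
      -(-1 : F) ^ l.length • (cross A b d (a ::ₘ c ::ₘ l) - cross A b c (a ::ₘ d ::ₘ l)
        - cross A a d (b ::ₘ c ::ₘ l) + cross A a c (b ::ₘ d ::ₘ l)) +
      (cross A d b (c ::ₘ a ::ₘ l) - cross A d a (c ::ₘ b ::ₘ l)
        - cross A c b (d ::ₘ a ::ₘ l) + cross A c a (d ::ₘ b ::ₘ l)) := by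
  have comm : ∀ (y : UnitalGrassmann F) (T : Subalgebra.center F (UnitalGrassmann F)),
      y * T.1 = T.1 * y := fun y T => (Subalgebra.mem_center_iff (R := F)).1 T.2 y
  have slide : ∀ (M S T : Subalgebra.center F (UnitalGrassmann F)) (y y' : UnitalGrassmann F),
      (M.1 * (S.1 * y)) * (T.1 * y') = (S.1 * (T.1 * M.1)) * (y * y') := by
    intro M S T y y'
    have h1 : y * (T.1 * y') = T.1 * (y * y') := by rw [← mul_assoc, comm y T, mul_assoc]
    have h2 : M.1 * S.1 * T.1 = S.1 * (T.1 * M.1) := by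
      rw [comm M.1 S, mul_assoc, comm M.1 T]
    rw [← h2, mul_assoc, mul_assoc S.1, h1]
    simp only [mul_assoc]
  have slide' : ∀ (M S T : Subalgebra.center F (UnitalGrassmann F)) (y y' : UnitalGrassmann F),
      (T.1 * y) * (M.1 * (S.1 * y')) = (T.1 * (S.1 * M.1)) * (y * y') := by
    intro M S T y y'
    have h1 : y * (M.1 * (S.1 * y')) = S.1 * M.1 * (y * y') := by
      rw [← mul_assoc, ← mul_assoc, mul_assoc y, ← comm M.1 S]
      have := comm y (M * S)
      rw [show (M * S).1 = M.1 * S.1 from rfl] at this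
      rw [this, mul_assoc]
    rw [mul_assoc, h1]
    simp only [mul_assoc]
  rw [lie_apply_zero_zero, act_apply_zero_one A l (lie_diag _ _),
    act_apply_one_zero A l (lie_diag _ _)]
  simp only [lie_apply_zero_one, lie_apply_one_zero, cross, weightProd_cons]
  simp only [← show ∀ i, (weight (A i)).1 = (A i).1 0 0 - (A i).1 1 1 from fun _ => rfl]
  simp only [weightProd]
  simp only [mul_sub, sub_mul, mul_neg, smul_mul_assoc, slide, slide']
  module

theorem map_act {K : Type*} [LieRing K] [LieAlgebra F K] (θ : K →ₗ⁅F⁆ lieM11 F) (x : ℕ → K)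
    (l : List ℕ) (u : K) : θ (act F x l u) = act F (fun i => θ (x i)) l (θ u) := by
  induction l with
  | nil => rfl
  | cons i l ih => rw [act_cons, act_cons, LieHom.map_lie, ih]

end Evaluation

/-! ### Linear independence of the coefficient functions -/

section Independence

attribute [local instance 100] LieRing.ofAssociativeRing

variable {F : Type*} [Field F]

theorem gen_mem_oddPart (i : ℕ) : gen F i ∈ oddPart F :=
  Submodule.subset_span ⟨[i], by simp, by simp [monomial]⟩

theorem pairSum_mem_evenPart (l : List ℕ) (r i : ℕ) :
    (pairSum F l r i : UnitalGrassmann F) ∈ evenPart F := by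
  induction l generalizing r with
  | nil => exact zero_mem _
  | cons j l ih =>
    refine add_mem ?_ (ih (r + 1))
    split_ifs
    · exact Submodule.subset_span ⟨_, by simp, by simp, rfl⟩
    · exact zero_mem _

/-- Matrices whose weights are the elements `pairSum F l 0 i` and whose only nonzero off-diagonal
entries are one generator in the first row and one in the second row. -/
noncomputable def testPoint (l : List ℕ) (p : ℕ × ℕ) (i : ℕ) : lieM11 F :=
  ⟨!![(pairSum F l 0 i : UnitalGrassmann F), if i = p.1 then gen F 0 else 0;
      if i = p.2 then gen F 1 else 0, 0], by
    refine ⟨pairSum_mem_evenPart l 0 i, zero_mem _, ?_, ?_⟩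
    · change (if i = p.1 then gen F 0 else 0) ∈ oddPart F
      split_ifs
      exacts [gen_mem_oddPart 0, zero_mem _]
    · change (if i = p.2 then gen F 1 else 0) ∈ oddPart F
      split_ifs
      exacts [gen_mem_oddPart 1, zero_mem _]⟩

theorem weightProd_testPoint (l : List ℕ) (p : ℕ × ℕ) (m : Multiset ℕ) :
    weightProd (testPoint (F := F) l p) m =
      ((m.map (pairSum F l 0)).prod : Subalgebra.center F (UnitalGrassmann F)) := by
  have : (fun i => weight (testPoint (F := F) l p i)) = pairSum F l 0 := by
    funext i
    apply Subtype.ext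
    exact sub_zero _
  rw [weightProd, this]

theorem linearCombination_eq_curry_sum {ι : Type*} [DecidableEq ι] (i₀ : ι)
    (T : Multiset ℕ → UnitalGrassmann F) (y : UnitalGrassmann F) (v : ι × Multiset ℕ →₀ F) :
    Finsupp.linearCombination F (fun p : ι × Multiset ℕ => T p.2 * if p.1 = i₀ then y else 0) v =
      (v.curry i₀).sum fun m c => c • (T m * y) := by
  change _ = Finsupp.linearCombination F (fun m => T m * y) (v.curry i₀)
  induction v using Finsupp.induction_linear with
  | zero =>
    rw [map_zero, show (0 : ι × Multiset ℕ →₀ F).curry i₀ = 0 by ext; simp, map_zero]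
  | add v w hv hw =>
    rw [map_add, hv, hw, ← map_add]
    congr 1
    ext
    simp
  | single p r =>
    obtain ⟨i, m⟩ := p
    rw [Finsupp.curry_single, Finsupp.linearCombination_single]
    by_cases h : i = i₀
    · subst h
      rw [if_pos rfl, Finsupp.single_eq_same, Finsupp.linearCombination_single]
    · rw [if_neg h, Finsupp.single_eq_of_ne (Ne.symm h), map_zero, mul_zero, smul_zero]

theorem eq_zero_of_curry_eq_zero {ι : Type*} {v : ι × Multiset ℕ →₀ F}
    (h : ∀ i, v.curry i = 0) : v = 0 := by
  ext ⟨i, m⟩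
  rw [← Finsupp.curry_apply, h]
  rfl

variable [CharZero F]

theorem eq_zero_of_forall_zero_one {v : ℕ × Multiset ℕ →₀ F}
    (h : ∀ A : ℕ → lieM11 F, Finsupp.linearCombination F
      (fun p : ℕ × Multiset ℕ => weightProd A p.2 * (A p.1).1 0 1) v = 0) : v = 0 := by
  refine eq_zero_of_curry_eq_zero fun i => eq_zero_of_sum_pairSum_eq_zero _ fun l => ?_
  rw [← linearCombination_eq_curry_sum i (fun m =>
    ((m.map (pairSum F l 0)).prod : Subalgebra.center F (UnitalGrassmann F)).1)]
  -- Multiplying by a second generator brings the sum to the form with the factor `gen F 0 * gen F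
  -- 1`; the second index of the test point plays no role.
  have h' := congrArg (LinearMap.mulRight F (gen F 1)) (h (testPoint l (i, 0)))
  rw [map_zero, Finsupp.apply_linearCombination] at h'
  refine Eq.trans (congrArg (fun g => Finsupp.linearCombination F g v) ?_) h'
  funext p
  simp only [Function.comp, LinearMap.mulRight_apply, weightProd_testPoint]
  change _ = _ * (if p.1 = i then gen F 0 else 0) * _
  rw [mul_assoc, ite_mul, zero_mul]

theorem eq_zero_of_forall_zero_zero {v : (ℕ × ℕ) × Multiset ℕ →₀ F}
    (h : ∀ A : ℕ → lieM11 F, Finsupp.linearCombination F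
      (fun p : (ℕ × ℕ) × Multiset ℕ => cross A p.1.1 p.1.2 p.2) v = 0) : v = 0 := by
  refine eq_zero_of_curry_eq_zero fun i => eq_zero_of_sum_pairSum_eq_zero _ fun l => ?_
  rw [← linearCombination_eq_curry_sum i (fun m =>
    ((m.map (pairSum F l 0)).prod : Subalgebra.center F (UnitalGrassmann F)).1)]
  refine Eq.trans (congrArg (fun g => Finsupp.linearCombination F g v) ?_) (h (testPoint l i))
  funext p
  rw [cross, weightProd_testPoint]
  change _ = _ * ((if p.1.1 = i.1 then gen F 0 else 0) * (if p.1.2 = i.2 then gen F 1 else 0))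
  obtain ⟨⟨a, b⟩, m⟩ := p
  obtain ⟨c, d⟩ := i
  simp only [Prod.mk.injEq]
  by_cases h1 : a = c <;> by_cases h2 : b = d <;> simp [h1, h2]

end Independence

/-! ### Recovering elements from the coefficients of their values -/

section Recovery

attribute [local instance 100] LieRing.ofAssociativeRing

variable {F : Type*} [Field F] {K : Type*} [LieRing K] [LieAlgebra F K]
  {x : ℕ → K}

variable (F x) in
/-- A left inverse, modulo the second derived algebra, of the upper right entry of the values. -/
noncomputable def recoverWord : (ℕ × Multiset ℕ →₀ F) →ₗ[F] K ⧸ secondDerived F K :=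
  Finsupp.linearCombination F fun p =>
    -- The empty multiset records a generator itself; it has no letter to differentiate by and is
    -- treated apart.
    if p.2 = 0 then (secondDerived F K).mkQ (x p.1)
    else ((-1) ^ (p.2.card + 1) / (p.2.card + 1) : F) •
      derivSum (fun k m' => word F x k p.1 m') p.2

variable (F x) in
/-- A left inverse, on the second derived algebra, of the diagonal entries of the values. -/
noncomputable def recoverPairing : ((ℕ × ℕ) × Multiset ℕ →₀ F) →ₗ[F] K :=
  Finsupp.linearCombination F fun p =>
    -- With cardinality `n + 2`, the bracketed factor is the scalar `n² + 5n + 5 - (-1)^n` of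
    -- `secondSum_alternating`; the 2 is there because a pairing contributes two families of cross
    -- terms.
    (-(-1) ^ p.2.card / (2 * ((p.2.card : F) ^ 2 + p.2.card - 1 - (-1) ^ p.2.card)) : F) •
      PairingRelations.secondSum (pairing F x) p.1.1 p.1.2 p.2

/-- The diagonal coefficients of an element of the second derived algebra. -/
noncomputable def crossCoeff (F : Type*) [Field F] (a b : ℕ) (m : Multiset ℕ) (c d : ℕ) :
    (ℕ × ℕ) × Multiset ℕ →₀ F :=
  Finsupp.single ((b, d), a ::ₘ c ::ₘ m) 1 - Finsupp.single ((b, c), a ::ₘ d ::ₘ m) 1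
    - Finsupp.single ((a, d), b ::ₘ c ::ₘ m) 1 + Finsupp.single ((a, c), b ::ₘ d ::ₘ m) 1

theorem cross_crossCoeff (A : ℕ → lieM11 F) (a b : ℕ) (m : Multiset ℕ) (c d : ℕ) :
    Finsupp.linearCombination F (fun p : (ℕ × ℕ) × Multiset ℕ => cross A p.1.1 p.1.2 p.2)
      (crossCoeff F a b m c d) =
    cross A b d (a ::ₘ c ::ₘ m) - cross A b c (a ::ₘ d ::ₘ m)
        - cross A a d (b ::ₘ c ::ₘ m) + cross A a c (b ::ₘ d ::ₘ m) := by
  simp only [crossCoeff, map_sub, map_add, Finsupp.linearCombination_single, one_smul]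

variable {θ : (ℕ → lieM11 F) → K →ₗ⁅F⁆ lieM11 F}

theorem map_pairing_coe (hK : IsCenterByMetabelian K) (hθ : ∀ A i, θ A (x i) = A i)
    (A : ℕ → lieM11 F) (a b : ℕ) (l : List ℕ) (c d : ℕ) :
    θ A (pairing F x a b l c d) = ⁅act F A l ⁅A a, A b⁆, ⁅A c, A d⁆⁆ := by
  rw [pairing_coe x hK, LieHom.map_lie, map_act, LieHom.map_lie, LieHom.map_lie]
  simp only [hθ]

variable [CharZero F]

theorem recoverWord_leftNormed (hK : IsCenterByMetabelian K) (a b : ℕ) (l : List ℕ) :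
    recoverWord F x ((-1 : F) ^ l.length •
      (Finsupp.single (b, a ::ₘ (l : Multiset ℕ)) 1 - Finsupp.single (a, b ::ₘ (l : Multiset ℕ)) 1))
      = (secondDerived F K).mkQ (act F x l ⁅x a, x b⁆) := by
  have h := derivSum_sub_derivSum (F := F) (word_anti (F := F) x) (word_jacobi (F := F) x hK) a b l
  have hne : ((l.length : F) + 2) ≠ 0 := by exact_mod_cast Nat.succ_ne_zero (l.length + 1)
  simp only [recoverWord, map_smul, map_sub, Finsupp.linearCombination_single, one_smul,
    Multiset.cons_ne_zero, if_false, Multiset.card_cons, Multiset.coe_card]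
  rw [← smul_sub, h, ← word_coe x hK, smul_smul, smul_smul, Multiset.coe_card]
  push_cast
  rw [show (l.length : F) + 1 + 1 = l.length + 2 by ring, mul_assoc, div_mul_cancel₀ _ hne,
    ← pow_add, show l.length + (l.length + 1 + 1) = 2 * (l.length + 1) by ring, pow_mul,
    neg_one_sq, one_pow, one_smul]

theorem recoverPairing_crossCoeff (hK : IsCenterByMetabelian K) (a b : ℕ) (m : Multiset ℕ)
    (c d : ℕ) :
    recoverPairing F x (crossCoeff F a b m c d) =
      (-(-1) ^ m.card / 2 : F) • pairing F x a b m c d := by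
  have h := (pairingRelations (F := F) x hK).secondSum_alternating a b m c d
  -- The scalar is `(n + 1)(n + 4)` for even `n` and `(n + 2)(n + 3)` for odd `n`.
  have hne : ((m.card : F) ^ 2 + 5 * m.card + 5 - (-1) ^ m.card) ≠ 0 := by
    rcases Nat.even_or_odd m.card with hm | hm
    · rw [hm.neg_one_pow, show (m.card : F) ^ 2 + 5 * m.card + 5 - 1 =
        ((m.card ^ 2 + 5 * m.card + 4 : ℕ) : F) by push_cast; ring]
      exact Nat.cast_ne_zero.2 (by positivity)
    · rw [hm.neg_one_pow, show (m.card : F) ^ 2 + 5 * m.card + 5 - -1 =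
        ((m.card ^ 2 + 5 * m.card + 6 : ℕ) : F) by push_cast; ring]
      exact Nat.cast_ne_zero.2 (by positivity)
  simp only [recoverPairing, crossCoeff, map_sub, map_add, Finsupp.linearCombination_single,
    one_smul, Multiset.card_cons]
  rw [← smul_sub, ← smul_sub, ← smul_add, h, smul_smul]
  congr 1
  push_cast
  rw [show ((m.card : F) + 1 + 1) ^ 2 + (m.card + 1 + 1) - 1 - (-1) ^ (m.card + 1 + 1) =
    (m.card : F) ^ 2 + 5 * m.card + 5 - (-1) ^ m.card by ring]
  rw [pow_succ, pow_succ, mul_assoc, neg_one_mul, neg_neg, mul_one, div_mul_eq_mul_div,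
    mul_div_mul_right _ _ hne]

/-- Each of the two coefficient families returns half of the pairing, the second one after `swap`.
-/
theorem recoverPairing_pairing (hK : IsCenterByMetabelian K) (a b : ℕ) (m : Multiset ℕ)
    (c d : ℕ) :
    recoverPairing F x (-(-1 : F) ^ m.card • crossCoeff F a b m c d + crossCoeff F c d m a b) =
      pairing F x a b m c d := by
  have hs : ((-1 : F) ^ m.card) * (-1) ^ m.card = 1 := by
    rw [← mul_pow, neg_one_mul, neg_neg, one_pow]
  rw [map_add, map_smul, recoverPairing_crossCoeff hK, recoverPairing_crossCoeff hK,
    (pairingRelations (F := F) x hK).swap a b m c d, smul_smul, smul_smul, ← add_smul]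
  convert one_smul F _ using 2
  linear_combination hs

/-- The values of an element of the second derived algebra are diagonal, and their coefficients
determine the element. -/
theorem exists_coeff_of_mem_secondDerived (hK : IsCenterByMetabelian K)
    (hx : ∀ S : LieSubalgebra F K, Set.range x ⊆ S → S = ⊤)
    (hθ : ∀ A i, θ A (x i) = A i) {q : K} (hq : q ∈ secondDerived F K) :
    (∀ A, (θ A q).1 0 1 = 0) ∧ ∃ v : (ℕ × ℕ) × Multiset ℕ →₀ F,
      (∀ A, (θ A q).1 0 0 = Finsupp.linearCombination F
        (fun p : (ℕ × ℕ) × Multiset ℕ => cross A p.1.1 p.1.2 p.2) v) ∧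
      recoverPairing F x v = q := by
  have hq' := secondDerived_le_span x hK hx hq
  clear hq
  induction hq' using Submodule.span_induction with
  | mem q h =>
    obtain ⟨a, b, l, c, d, rfl⟩ := h
    refine ⟨fun A => ?_, _, fun A => ?_, recoverPairing_pairing hK a b l c d⟩
    · rw [map_pairing_coe hK hθ, lie_leftNormed_apply_zero_one]
    · rw [map_pairing_coe hK hθ, lie_leftNormed_apply_zero_zero, map_add, map_smul,
        cross_crossCoeff, cross_crossCoeff, Multiset.coe_card]
  | zero => exact ⟨fun A => by rw [map_zero]; rfl, 0, fun A => by rw [map_zero, map_zero]; rfl,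
      map_zero _⟩
  | add q q' _ _ h h' =>
    obtain ⟨h1, v, h2, h3⟩ := h
    obtain ⟨h1', v', h2', h3'⟩ := h'
    refine ⟨fun A => ?_, v + v', fun A => ?_, by rw [map_add, h3, h3']⟩
    · rw [map_add]
      exact (congrArg₂ (· + ·) (h1 A) (h1' A)).trans (add_zero _)
    · rw [map_add, map_add, ← h2 A, ← h2' A]
      rfl
  | smul r q _ h =>
    obtain ⟨h1, v, h2, h3⟩ := h
    refine ⟨fun A => ?_, r • v, fun A => ?_, by rw [map_smul, h3]⟩
    · rw [map_smul]
      exact (congrArg (r • ·) (h1 A)).trans (smul_zero _)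
    · rw [map_smul, map_smul, ← h2 A]
      rfl

/-- The coefficients of the upper right entries of the values of an element determine it modulo
the second derived algebra. -/
theorem exists_coeff (hK : IsCenterByMetabelian K)
    (hx : ∀ S : LieSubalgebra F K, Set.range x ⊆ S → S = ⊤)
    (hθ : ∀ A i, θ A (x i) = A i) (q : K) :
    ∃ v : ℕ × Multiset ℕ →₀ F,
      (∀ A, (θ A q).1 0 1 = Finsupp.linearCombination F
        (fun p : ℕ × Multiset ℕ => weightProd A p.2 * (A p.1).1 0 1) v) ∧
      recoverWord F x v = (secondDerived F K).mkQ q := by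
  have hq := mem_span_leftNormed x hK hx q
  induction hq using Submodule.span_induction with
  | mem q h =>
    rcases h with ⟨i, rfl⟩ | ⟨a, b, l, rfl⟩ | h
    · refine ⟨Finsupp.single (i, 0) 1, fun A => ?_, ?_⟩
      · rw [hθ, Finsupp.linearCombination_single, one_smul, weightProd_zero, one_mul]
      · rw [recoverWord, Finsupp.linearCombination_single, one_smul, if_pos rfl]
    · refine ⟨_, fun A => ?_, recoverWord_leftNormed hK a b l⟩
      rw [map_act, LieHom.map_lie]
      simp only [hθ]
      rw [leftNormed_apply_zero_one, map_smul, map_sub, Finsupp.linearCombination_single,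
        Finsupp.linearCombination_single, one_smul, one_smul]
    · refine ⟨0, fun A => ?_, ?_⟩
      · rw [map_zero]
        exact (exists_coeff_of_mem_secondDerived hK hx hθ h).1 A
      · rw [map_zero, eq_comm, Submodule.mkQ_apply, Submodule.Quotient.mk_eq_zero]
        exact h
  | zero => exact ⟨0, fun A => by rw [map_zero, map_zero]; rfl, by rw [map_zero, map_zero]⟩
  | add q q' _ _ h h' =>
    obtain ⟨v, h2, h3⟩ := h
    obtain ⟨v', h2', h3'⟩ := h'
    refine ⟨v + v', fun A => ?_, by rw [map_add, h3, h3', map_add]⟩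
    rw [map_add, map_add, ← h2 A, ← h2' A]
    rfl
  | smul r q _ h =>
    obtain ⟨v, h2, h3⟩ := h
    refine ⟨r • v, fun A => ?_, by rw [map_smul, h3, map_smul]⟩
    rw [map_smul, map_smul, ← h2 A]
    rfl

/-- The values in `M_{1,1}(E)` separate the elements of a relatively free center-by-metabelian
Lie algebra. -/
theorem eq_zero_of_forall_map_eq_zero (hK : IsCenterByMetabelian K)
    (hx : ∀ S : LieSubalgebra F K, Set.range x ⊆ S → S = ⊤)
    (hθ : ∀ A i, θ A (x i) = A i) {q : K} (hq : ∀ A, θ A q = 0) : q = 0 := by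
  -- The upper right entries put `q` in the second derived algebra; only then do the diagonal
  -- entries determine it.
  have mem : q ∈ secondDerived F K := by
    obtain ⟨v, hv, hv'⟩ := exists_coeff hK hx hθ q
    have : v = 0 := eq_zero_of_forall_zero_one fun A => by rw [← hv A, hq A]; rfl
    rwa [this, map_zero, eq_comm, Submodule.mkQ_apply, Submodule.Quotient.mk_eq_zero] at hv'
  obtain ⟨-, v, hv, hv'⟩ := exists_coeff_of_mem_secondDerived hK hx hθ mem
  have : v = 0 := eq_zero_of_forall_zero_zero fun A => by rw [← hv A, hq A]; rfl
  rw [← hv', this, map_zero]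

end Recovery

/-! ### The relatively free algebra and its evaluations -/

section Free

variable {F : Type*} [Field F] {L : Type*} [LieRing L] [LieAlgebra F L]

/-- The quotient map of a Lie ideal as a morphism of Lie algebras. -/
def quotientMap (I : LieIdeal F L) : L →ₗ⁅F⁆ L ⧸ I :=
  { I.toSubmodule.mkQ with
    map_lie' := fun {u v} => LieSubmodule.Quotient.mk_bracket I u v }

theorem quotientMap_eq_zero_iff (I : LieIdeal F L) (u : L) : quotientMap I u = 0 ↔ u ∈ I :=
  LieSubmodule.Quotient.mk_eq_zero I

theorem quotientMap_surjective (I : LieIdeal F L) : Function.Surjective (quotientMap I) :=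
  I.toSubmodule.mkQ_surjective

/-- The morphism induced on the quotient by a Lie ideal. -/
def quotientLift {M : Type*} [LieRing M] [LieAlgebra F M] (I : LieIdeal F L) (f : L →ₗ⁅F⁆ M)
    (h : I ≤ f.ker) : L ⧸ I →ₗ⁅F⁆ M :=
  { I.toSubmodule.liftQ (f : L →ₗ[F] M) (fun u hu => (LieHom.mem_ker).1 (h hu)) with
    map_lie' := fun {u v} => by
      obtain ⟨u, rfl⟩ := quotientMap_surjective I u
      obtain ⟨v, rfl⟩ := quotientMap_surjective I v
      rw [← LieHom.map_lie]
      exact LieHom.map_lie f u v }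

theorem quotientLift_quotientMap {M : Type*} [LieRing M] [LieAlgebra F M] (I : LieIdeal F L)
    (f : L →ₗ⁅F⁆ M) (h : I ≤ f.ker) (u : L) : quotientLift I f h (quotientMap I u) = f u :=
  rfl

/-- By freeness the quotient map factors through `S`, and it is surjective. -/
theorem eq_top_of_generators_mem (I : LieIdeal F (LiePoly F)) (S : LieSubalgebra F (LiePoly F ⧸ I))
    (hS : (Set.range fun i => quotientMap I (X F i)) ⊆ S) : S = ⊤ := by
  let g : LiePoly F →ₗ⁅F⁆ S :=
    FreeLieAlgebra.lift F fun i => ⟨quotientMap I (X F i), hS ⟨i, rfl⟩⟩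
  have hg : S.incl.comp g = quotientMap I := FreeLieAlgebra.hom_ext fun i => by
    rw [LieHom.comp_apply, FreeLieAlgebra.lift_of_apply]
    rfl
  rw [eq_top_iff]
  intro q _
  obtain ⟨f, rfl⟩ := quotientMap_surjective I q
  rw [← hg]
  exact (g f).2

theorem eval_identity {M : Type*} [LieRing M] [LieAlgebra F M] (g : ℕ → M) :
    eval g ⁅⁅⁅X F 0, X F 1⁆, ⁅X F 2, X F 3⁆⁆, X F 4⁆ = ⁅⁅⁅g 0, g 1⁆, ⁅g 2, g 3⁆⁆, g 4⁆ := by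
  simp only [eval, X, LieHom.map_lie, FreeLieAlgebra.lift_of_apply]

theorem consequences_le_ker {M : Type*} [LieRing M] [LieAlgebra F M]
    (hM : IsCenterByMetabelian M) (a : ℕ → M) :
    consequences {⁅⁅⁅X F 0, X F 1⁆, ⁅X F 2, X F 3⁆⁆, X F 4⁆} ≤
      (FreeLieAlgebra.lift F a).ker := by
  refine LieSubmodule.lieSpan_le.2 ?_
  rintro _ ⟨_, rfl, g, rfl⟩
  rw [SetLike.mem_coe, LieHom.mem_ker, eval_identity]
  simp only [LieHom.map_lie]
  exact hM _ _ _ _ _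

variable (F) in
theorem isCenterByMetabelian_quotient : IsCenterByMetabelian
    (LiePoly F ⧸ consequences {⁅⁅⁅X F 0, X F 1⁆, ⁅X F 2, X F 3⁆⁆, X F 4⁆}) := by
  intro a b c d e
  obtain ⟨a, rfl⟩ := quotientMap_surjective _ a
  obtain ⟨b, rfl⟩ := quotientMap_surjective _ b
  obtain ⟨c, rfl⟩ := quotientMap_surjective _ c
  obtain ⟨d, rfl⟩ := quotientMap_surjective _ d
  obtain ⟨e, rfl⟩ := quotientMap_surjective _ e
  simp only [← LieHom.map_lie]
  rw [quotientMap_eq_zero_iff]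
  let g : ℕ → LiePoly F
    | 0 => a
    | 1 => b
    | 2 => c
    | 3 => d
    | _ => e
  exact LieSubmodule.subset_lieSpan ⟨_, rfl, g, (eval_identity g).symm⟩

end Free

end LieIdentities

theorem theorem2 (F : Type*) [Field F] [CharZero F] :
    LieIdentities.IsIdentityBasis (F := F) (LieIdentities.lieM11 F)
      {⁅⁅⁅LieIdentities.X F 0, LieIdentities.X F 1⁆,
          ⁅LieIdentities.X F 2, LieIdentities.X F 3⁆⁆, LieIdentities.X F 4⁆} := by
  intro f
  have hM := LieIdentities.isCenterByMetabelian_lieM11 F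
  constructor
  · intro hf
    rw [← LieIdentities.quotientMap_eq_zero_iff]
    refine LieIdentities.eq_zero_of_forall_map_eq_zero
      (θ := fun A => LieIdentities.quotientLift _ (FreeLieAlgebra.lift F A)
        (LieIdentities.consequences_le_ker hM A))
      (LieIdentities.isCenterByMetabelian_quotient F)
      (LieIdentities.eq_top_of_generators_mem _) (fun A i => ?_) fun A => ?_
    · rw [LieIdentities.quotientLift_quotientMap]
      exact FreeLieAlgebra.lift_of_apply A i
    · rw [LieIdentities.quotientLift_quotientMap]
      exact hf A
  · intro hf a
    exact (LieHom.mem_ker).1 (LieIdentities.consequences_le_ker hM a hf)
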